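/- Let $q$ be an indeterminate. For $k\ge 0$ put $(a;q)_0=1$, $(a;q)_k=(1-a)(1-aq)\cdots(1-aq^{k-1})$ for $k\ge1$, and $[m]=1+q+\cdots+q^{m-1}$; let $\Phi_n(q)$ be the $n$-th cyclotomic polynomial. For rational functions $A,B\in\mathbb{Q}(q)$ and a polynomial $P\in\mathbb{Q}[q]$, write $A\equiv B\pmod P$ if $P$ divides the numerator of $A-B$ written in lowest terms. Let $n$ be a positive odd integer, and for $k\ge 0$ let $$c_q(k)=[4k+1]\frac{(q;q^2)_k^6}{(q^2;q^2)_k^6}\,q^k.$$ Then $$\sum_{k=0}^{n-1}\sum_{j=0}^{k}c_q(j)\,c_q(k-j)\equiv q^{1-n}[n]^2\left(\sum_{k=0}^{(n-1)/2}\frac{(q;q^2)_k^4}{(q^2;q^2)_k^4}\,q^{2k}\right)^2\pmod{[n]\,\Phi_n(q)^2}.$$ -/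

import Mathlib

open Polynomial

noncomputable section

/-- The `q`-shifted factorial `(a; q)_k = (1 - a) (1 - a q) ⋯ (1 - a q ^ (k - 1))`, with value `1`
for `k = 0`. -/
def qShiftedFactorial {R : Type*} [CommRing R] (a q : R) (k : ℕ) : R :=
  ∏ i ∈ Finset.range k, (1 - a * q ^ i)

/-- The `q`-integer `[m] = 1 + q + ⋯ + q ^ (m - 1)`. -/
def qInteger {R : Type*} [CommRing R] (q : R) (m : ℕ) : R :=
  ∑ i ∈ Finset.range m, q ^ i

/-- Congruence `A ≡ B (mod P)` of rational functions modulo a polynomial: `P` divides the numerator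
of `A - B` written in lowest terms. -/
def RatFuncCongruent (P : ℚ[X]) (A B : RatFunc ℚ) : Prop :=
  P ∣ (A - B).num

/-- The term `c_q(k) = [4k + 1] (q; q²)_k ^ 6 / (q²; q²)_k ^ 6 * q ^ k`, a rational function in the
indeterminate `q = RatFunc.X`. -/
def cTerm (k : ℕ) : RatFunc ℚ :=
  qInteger RatFunc.X (4 * k + 1) *
    (qShiftedFactorial RatFunc.X (RatFunc.X ^ 2) k ^ 6 /
      qShiftedFactorial (RatFunc.X ^ 2) (RatFunc.X ^ 2) k ^ 6) * RatFunc.X ^ k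

end

/-! The modulus [n]Φ_n² is the product of Φ_n³ and the pairwise coprime Φ_d with d ∣ n, 1 < d < n,
so the congruence is tested in one Φ_d-adic valuation at a time. Of these valuations the argument
uses only `Valuation.IsCyclotomic`. Write d = 2M + 1, C = ∑_{k ≤ M} c_q(k) and S = ∑_{k ≤ M}
(q;q²)_k⁴ / (q²;q²)_k⁴ q^{2k}.

Replacing (q;q²)_k² by (q^{1+d}, q^{1-d}; q²)_k, and (q²;q²)_k² likewise, costs only a multiple of
(1 - q^d)². The modified series terminates and Watson's transformation evaluates it, so q^M C ≡ [d]
S mod Φ_d² (`congMod_sum_cTermAt`). In particular Φ_d divides C.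

For d = n, Φ_n⁶ divides c_q(k) when M < k < n, and two indices at most M add up to less than n. The
truncated convolution is therefore C² mod Φ_n⁶. As q^M C - [n]S is divisible by Φ_n² and q^M C +
[n]S by Φ_n, the squares agree mod Φ_n³, and q^{-2M} = q^{1-n}.

For d < n the right side vanishes mod Φ_d because of [n]. On the left, a Lucas-type congruence
c_q(da + b) ≡ l(a) c_q(b) for b < d makes the convolution an integral multiple of C² mod Φ_d, hence
zero. -/

noncomputable section

/-! ### Watson's transformation by Bailey's method -/

section Watson

local notation:max "A" q:max k:max => qShiftedFactorial q (q ^ 2) k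
local notation:max "B" q:max k:max => qShiftedFactorial (q ^ 2) (q ^ 2) k

variable {K : Type*} [Field K]

lemma qShiftedFactorial_zero (a q : K) : qShiftedFactorial a q 0 = 1 := by
  simp [qShiftedFactorial]

lemma qShiftedFactorial_odd_succ (q : K) (k : ℕ) :
    A q (k + 1) = A q k * (1 - q ^ (2 * k + 1)) := by
  rw [qShiftedFactorial, Finset.prod_range_succ, ← qShiftedFactorial]
  ring

lemma qShiftedFactorial_even_succ (q : K) (k : ℕ) :
    B q (k + 1) = B q k * (1 - q ^ (2 * k + 2)) := by
  rw [qShiftedFactorial, Finset.prod_range_succ, ← qShiftedFactorial]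
  ring

lemma qShiftedFactorial_odd_ne_zero {q : K} (hq : ∀ m, 0 < m → 1 - q ^ m ≠ 0) (k : ℕ) :
    A q k ≠ 0 := by
  induction k with
  | zero => simp [qShiftedFactorial]
  | succ k ih => rw [qShiftedFactorial_odd_succ]; exact mul_ne_zero ih (hq _ (by omega))

lemma qShiftedFactorial_even_ne_zero {q : K} (hq : ∀ m, 0 < m → 1 - q ^ m ≠ 0) (k : ℕ) :
    B q k ≠ 0 := by
  induction k with
  | zero => simp [qShiftedFactorial]
  | succ k ih => rw [qShiftedFactorial_even_succ]; exact mul_ne_zero ih (hq _ (by omega))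

/-- A terminating very-well-poised `₆φ₅` summation in base `q ^ 2`. -/
lemma sum_six_phi_five {q : K} (hq : ∀ m, 0 < m → 1 - q ^ m ≠ 0) (L : ℕ) :
    ∑ r ∈ Finset.range (L + 1), (1 - q ^ (4 * r + 1)) * A q r ^ 3 * (-1) ^ r * q ^ (r ^ 2) /
      (B q r ^ 3 * B q (L - r) * A q (L + r + 1)) = A q L / B q L ^ 3 := by
  have hA := qShiftedFactorial_odd_ne_zero hq
  have hB := qShiftedFactorial_even_ne_zero hq
  induction L with
  | zero =>
    have := hq 1 one_pos
    rw [pow_one] at this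
    simp [qShiftedFactorial, this]
  | succ L ih =>
    -- A WZ-style certificate: the summand at L + 1 is a multiple, free of r, of the summand at L
    -- plus a difference of `g`.
    set g : ℕ → K := fun r => -(-1) ^ r * q ^ (r ^ 2 + 2 * (L + 1 - r)) * (1 - q ^ (2 * r)) ^ 3 *
      A q r ^ 3 / (B q r ^ 3 * B q (L + 1 - r) * A q (L + r + 1)) /
        (1 - q ^ (2 * L + 2)) ^ 3 with hg
    have key : ∀ r ∈ Finset.range (L + 1),
        (1 - q ^ (4 * r + 1)) * A q r ^ 3 * (-1) ^ r * q ^ (r ^ 2) /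
          (B q r ^ 3 * B q (L + 1 - r) * A q (L + 1 + r + 1)) =
        (1 - q ^ (2 * L + 1)) / (1 - q ^ (2 * L + 2)) ^ 3 *
          ((1 - q ^ (4 * r + 1)) * A q r ^ 3 * (-1) ^ r * q ^ (r ^ 2) /
            (B q r ^ 3 * B q (L - r) * A q (L + r + 1))) + (g (r + 1) - g r) := by
      intro r hr
      obtain ⟨t, rfl⟩ := Nat.exists_eq_add_of_le (Nat.lt_succ_iff.1 (Finset.mem_range.1 hr))
      simp only [hg, show r + t + 1 - r = t + 1 by omega, show r + t - r = t by omega,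
        show r + t + 1 - (r + 1) = t by omega, show r + t + 1 + r + 1 = r + t + r + 1 + 1 by omega,
        show r + t + (r + 1) + 1 = r + t + r + 1 + 1 by omega]
      rw [qShiftedFactorial_even_succ q t, qShiftedFactorial_even_succ q r,
        qShiftedFactorial_odd_succ q (r + t + r + 1), qShiftedFactorial_odd_succ q r]
      have h1 := hA (r + t + r + 1)
      have h2 := hA r
      have h3 := hB r
      have h4 := hB t
      have h5 := hq (2 * t + 2) (by omega)
      have h6 := hq (2 * r + 2) (by omega)
      have h7 := hq (2 * (r + t) + 2) (by omega)
      have h8 := hq (2 * (r + t + r + 1) + 1) (by omega)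
      rw [show 2 * (r + 1) = 2 * r + 2 by ring]
      generalize A q (r + t + r + 1) = a1 at *
      generalize A q r = a2 at *
      generalize B q r = b1 at *
      generalize B q t = b2 at *
      field_simp
      ring
    rw [Finset.sum_range_succ, Finset.sum_congr rfl key, Finset.sum_add_distrib, ← Finset.mul_sum,
      Finset.sum_range_sub, ih]
    have h0 : g 0 = 0 := by simp [hg]
    -- The telescoped boundary value cancels the top term r = L + 1, which has no counterpart in the
    -- sum for L.
    have h1 : g (L + 1) = - ((1 - q ^ (4 * (L + 1) + 1)) * A q (L + 1) ^ 3 * (-1) ^ (L + 1) *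
        q ^ ((L + 1) ^ 2) / (B q (L + 1) ^ 3 * B q (L + 1 - (L + 1)) *
          A q (L + 1 + (L + 1) + 1))) := by
      simp only [hg, Nat.sub_self, qShiftedFactorial_zero,
        show L + 1 + (L + 1) + 1 = L + (L + 1) + 1 + 1 by omega]
      rw [qShiftedFactorial_odd_succ q (L + (L + 1) + 1)]
      have h1 := hA (L + (L + 1) + 1)
      have h3 := hB (L + 1)
      have h6 := hq (2 * L + 2) (by omega)
      have h8 := hq (2 * (L + (L + 1) + 1) + 1) (by omega)
      rw [show 2 * (L + 1) = 2 * L + 2 by ring]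
      field_simp
      ring
    rw [h0, h1, sub_zero, neg_add_cancel_right, qShiftedFactorial_even_succ, qShiftedFactorial_odd_succ]
    have h3 := hB L
    have h6 := hq (2 * L + 2) (by omega)
    field_simp

/-- A `q`-Pfaff–Saalschütz summation in base `q ^ 2`. -/
lemma sum_saalschutz {q : K} (hq : ∀ m, 0 < m → 1 - q ^ m ≠ 0) (r s : ℕ) :
    ∑ m ∈ Finset.range (s + 1), (-1) ^ m * q ^ ((s - m) ^ 2 + m) * A q (r + m) *
        B q (2 * r + s + m) / (B q (s - m) * B q (r + m) * B q m * A q (2 * r + m + 1)) =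
      q ^ (2 * r * s + s ^ 2 + s) * A q r * B q (2 * r + s) * A q s /
        (B q r * B q s * A q (2 * r + s + 1)) := by
  have hA := qShiftedFactorial_odd_ne_zero hq
  have hB := qShiftedFactorial_even_ne_zero hq
  induction s with
  | zero => simp [qShiftedFactorial_zero]
  | succ s ih =>
    -- Again a telescoping certificate, for the recurrence in s with r fixed.
    set g : ℕ → K := fun m => -(-1) ^ m * q ^ ((s + 1 - m) * (s + 1 - m + 1) + s + 1) *
      (1 + q ^ (2 * r + 2 * s + 2)) * (1 - q ^ (2 * m)) * (1 - q ^ (2 * r + 2 * m)) *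
      A q (r + m) * B q (2 * r + s + m) / (B q (s + 1 - m) * B q (r + m) * B q m *
        A q (2 * r + m)) / ((1 - q ^ (2 * s + 2)) * (1 - q ^ (4 * r + 2 * s + 3))) with hg
    have key : ∀ m ∈ Finset.range (s + 1),
        (-1) ^ m * q ^ ((s + 1 - m) ^ 2 + m) * A q (r + m) * B q (2 * r + (s + 1) + m) /
          (B q (s + 1 - m) * B q (r + m) * B q m * A q (2 * r + m + 1)) =
        q ^ (2 * r + 2 * s + 2) * (1 - q ^ (4 * r + 2 * s + 2)) * (1 - q ^ (2 * s + 1)) /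
            ((1 - q ^ (2 * s + 2)) * (1 - q ^ (4 * r + 2 * s + 3))) *
          ((-1) ^ m * q ^ ((s - m) ^ 2 + m) * A q (r + m) * B q (2 * r + s + m) /
            (B q (s - m) * B q (r + m) * B q m * A q (2 * r + m + 1))) + (g (m + 1) - g m) := by
      intro m hm
      obtain ⟨t, rfl⟩ := Nat.exists_eq_add_of_le (Nat.lt_succ_iff.1 (Finset.mem_range.1 hm))
      simp only [hg, show m + t + 1 - m = t + 1 by omega, show m + t - m = t by omega,
        show m + t + 1 - (m + 1) = t by omega,
        show 2 * r + (m + t + 1) + m = 2 * r + (m + t) + m + 1 by omega,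
        show 2 * r + (m + t) + (m + 1) = 2 * r + (m + t) + m + 1 by omega,
        show r + (m + 1) = r + m + 1 by omega, show 2 * r + (m + 1) = 2 * r + m + 1 by omega]
      rw [qShiftedFactorial_even_succ q t, qShiftedFactorial_even_succ q m,
        qShiftedFactorial_even_succ q (r + m), qShiftedFactorial_odd_succ q (r + m),
        qShiftedFactorial_even_succ q (2 * r + (m + t) + m),
        qShiftedFactorial_odd_succ q (2 * r + m)]
      have h1 := hA (2 * r + m)
      have h3 := hB (r + m)
      have h3' := hB m
      have h4 := hB t
      have h5 := hq (2 * t + 2) (by omega)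
      have h6 := hq (2 * m + 2) (by omega)
      have h7 := hq (2 * (m + t) + 2) (by omega)
      have h8 := hq (2 * (r + m) + 2) (by omega)
      have h9 := hq (4 * r + 2 * (m + t) + 3) (by omega)
      have h10 := hq (2 * (2 * r + m) + 1) (by omega)
      rw [show 2 * (m + 1) = 2 * m + 2 by ring, show 2 * r + (2 * m + 2) = 2 * (r + m) + 2 by ring]
      generalize A q (2 * r + m) = a1 at *
      generalize A q (r + m) = a2 at *
      generalize B q m = b1 at *
      generalize B q t = b2 at *
      generalize B q (r + m) = b3 at *
      generalize B q (2 * r + (m + t) + m) = b4 at *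
      field_simp
      ring
    rw [Finset.sum_range_succ, Finset.sum_congr rfl key, Finset.sum_add_distrib, ← Finset.mul_sum,
      Finset.sum_range_sub, ih]
    have h0 : g 0 = 0 := by simp [hg]
    have h1 : g (s + 1) = -((-1) ^ (s + 1) * q ^ ((s + 1 - (s + 1)) ^ 2 + (s + 1)) *
        A q (r + (s + 1)) * B q (2 * r + (s + 1) + (s + 1)) /
          (B q (s + 1 - (s + 1)) * B q (r + (s + 1)) * B q (s + 1) *
            A q (2 * r + (s + 1) + 1))) := by
      simp only [hg, Nat.sub_self, qShiftedFactorial_zero,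
        show 2 * r + (s + 1) + (s + 1) = 2 * r + s + (s + 1) + 1 by omega]
      rw [qShiftedFactorial_odd_succ q (2 * r + (s + 1)),
        qShiftedFactorial_even_succ q (2 * r + s + (s + 1))]
      have h1 := hA (2 * r + (s + 1))
      have h3 := hB (s + 1)
      have h4 := hB (r + (s + 1))
      have h6 := hq (2 * s + 2) (by omega)
      have h8 := hq (4 * r + 2 * s + 3) (by omega)
      rw [show 2 * (s + 1) = 2 * s + 2 by ring,
        show 2 * (2 * r + (s + 1)) + 1 = 4 * r + 2 * s + 3 by ring]
      field_simp
      ring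
    rw [h0, h1, sub_zero, neg_add_cancel_right, show 2 * r + (s + 1) = 2 * r + s + 1 by omega, qShiftedFactorial_even_succ q s,
      qShiftedFactorial_odd_succ q s, qShiftedFactorial_even_succ q (2 * r + s),
      qShiftedFactorial_odd_succ q (2 * r + s + 1)]
    have h1 := hA (2 * r + s + 1)
    have h3 := hB r
    have h4 := hB s
    have h6 := hq (2 * s + 2) (by omega)
    have h8 := hq (4 * r + 2 * s + 3) (by omega)
    rw [show 2 * (2 * r + s + 1) + 1 = 4 * r + 2 * s + 3 by ring]
    field_simp
    ring

/-- A special case of Watson's transformation of a terminating very-well-poised `₈φ₇` series into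
a balanced `₄φ₃` series, in base `q ^ 2`. -/
lemma watson_transformation {q : K} (hq : ∀ m, 0 < m → 1 - q ^ m ≠ 0) (N : ℕ) :
    q ^ (N ^ 2 + N) * ∑ r ∈ Finset.range (N + 1), (1 - q ^ (4 * r + 1)) * A q r ^ 4 *
        B q (N + r) * A q (N - r) / (B q r ^ 4 * B q (N - r) * A q (N + r + 1)) =
      ∑ L ∈ Finset.range (N + 1), (-1) ^ L * q ^ ((N - L) ^ 2 + L) * A q L ^ 2 * B q (N + L) /
        (B q L ^ 4 * B q (N - L)) := by
  have hA := qShiftedFactorial_odd_ne_zero hq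
  have hB := qShiftedFactorial_even_ne_zero hq
  -- Bailey's method: expand the factor (q;q²)_L / (q²;q²)_L³ by the ₆φ₅ sum, interchange the
  -- summations, and evaluate the inner sum by Saalschütz.
  have expand : ∀ L ∈ Finset.range (N + 1),
      (-1) ^ L * q ^ ((N - L) ^ 2 + L) * A q L ^ 2 * B q (N + L) / (B q L ^ 4 * B q (N - L)) =
      ∑ r ∈ Finset.range (L + 1), (1 - q ^ (4 * r + 1)) * A q r ^ 3 * (-1) ^ r * q ^ (r ^ 2) /
        B q r ^ 3 * ((-1) ^ L * q ^ ((N - L) ^ 2 + L) * A q L * B q (N + L) /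
          (B q (N - L) * B q L * B q (L - r) * A q (L + r + 1))) := by
    intro L _
    rw [show (-1) ^ L * q ^ ((N - L) ^ 2 + L) * A q L ^ 2 * B q (N + L) /
        (B q L ^ 4 * B q (N - L)) = (-1) ^ L * q ^ ((N - L) ^ 2 + L) * A q L * B q (N + L) /
          (B q (N - L) * B q L) * (A q L / B q L ^ 3) by
        have := hB L
        have := hB (N - L)
        field_simp, ← sum_six_phi_five hq L, Finset.mul_sum]
    refine Finset.sum_congr rfl fun r _ => ?_
    have := hB L
    have := hB r
    have := hB (N - L)
    have := hB (L - r)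
    have := hA (L + r + 1)
    field_simp
  rw [Finset.sum_congr rfl expand,
    Finset.sum_comm' (s' := fun r => Finset.Ico r (N + 1)) (t' := Finset.range (N + 1))
      (by intro x y; simp only [Finset.mem_range, Finset.mem_Ico]; omega), Finset.mul_sum]
  refine Finset.sum_congr rfl fun r hr => ?_
  obtain ⟨s, rfl⟩ := Nat.exists_eq_add_of_le (Nat.lt_succ_iff.1 (Finset.mem_range.1 hr))
  rw [← Finset.mul_sum, Finset.sum_Ico_eq_sum_range, show r + s + 1 - r = s + 1 by omega]
  have inner : ∑ m ∈ Finset.range (s + 1),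
      (-1) ^ (r + m) * q ^ ((r + s - (r + m)) ^ 2 + (r + m)) * A q (r + m) *
        B q (r + s + (r + m)) / (B q (r + s - (r + m)) * B q (r + m) * B q (r + m - r) *
          A q (r + m + r + 1)) =
      (-1) ^ r * q ^ r * (q ^ (2 * r * s + s ^ 2 + s) * A q r * B q (2 * r + s) * A q s /
        (B q r * B q s * A q (2 * r + s + 1))) := by
    rw [← sum_saalschutz hq r s, Finset.mul_sum]
    refine Finset.sum_congr rfl fun m _ => ?_
    rw [show r + s - (r + m) = s - m by omega, show r + s + (r + m) = 2 * r + s + m by ring,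
      show r + m - r = m by omega, show r + m + r + 1 = 2 * r + m + 1 by ring]
    ring
  rw [inner, show r + s - r = s by omega, show r + s + r = 2 * r + s by ring,
    show q ^ ((r + s) ^ 2 + (r + s)) = q ^ r * q ^ (r ^ 2) * q ^ (2 * r * s + s ^ 2 + s) by ring]
  have sgn : (-1 : K) ^ r * (-1) ^ r = 1 := by rw [← mul_pow]; simp
  generalize q ^ (2 * r * s + s ^ 2 + s) = x
  generalize A q (2 * r + s + 1) = a
  generalize B q (2 * r + s) = b
  generalize q ^ (4 * r + 1) = y
  generalize q ^ (r ^ 2) = z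
  generalize q ^ r = w
  generalize (-1 : K) ^ r = e at *
  rw [← one_mul (w * z * x * _), ← sgn]
  ring

/-- The product `(q ^ e * y, q ^ e / y; q ^ 2)_k`. -/
def qShiftedPair (q y : K) (e k : ℕ) : K :=
  ∏ j ∈ Finset.range k, (1 - q ^ (2 * j + e) * y) * (1 - q ^ (2 * j + e) / y)

lemma qShiftedPair_succ (q y : K) (e k : ℕ) :
    qShiftedPair q y e (k + 1) =
      qShiftedPair q y e k * ((1 - q ^ (2 * k + e) * y) * (1 - q ^ (2 * k + e) / y)) :=
  Finset.prod_range_succ _ _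

/-- At y = q^{2N+1} the factors are 1 - q^{2(N+j+1)} and 1 - q^{-2(N-j)}. Reversing the signs of the
negative exponents turns the pair into (q²;q²)_{N+r} / (q²;q²)_{N-r} up to a monomial. -/
lemma qShiftedPair_one_eq {q : K} (h0 : q ≠ 0) {N r : ℕ} (hr : r ≤ N) :
    qShiftedPair q (q ^ (2 * N + 1)) 1 r * q ^ (2 * N * r + r) * B q (N - r) =
      (-1) ^ r * q ^ (r ^ 2) * B q (N + r) := by
  induction r with
  | zero => simp [qShiftedPair]
  | succ r ih =>
    obtain ⟨s, rfl⟩ := Nat.exists_eq_add_of_le hr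
    have ih := ih (by omega)
    rw [show r + 1 + s - r = s + 1 by omega, qShiftedFactorial_even_succ] at ih
    rw [show r + 1 + s - (r + 1) = s by omega, ← add_assoc (r + 1 + s) r 1,
      qShiftedFactorial_even_succ, qShiftedPair_succ]
    have e : (1 - q ^ (2 * r + 1) / q ^ (2 * (r + 1 + s) + 1)) * q ^ (2 * s + 2) =
        - (1 - q ^ (2 * s + 2)) := by
      field_simp
      ring
    calc _ = (qShiftedPair q (q ^ (2 * (r + 1 + s) + 1)) 1 r * q ^ (2 * (r + 1 + s) * r + r) *
          B q s) * ((1 - q ^ (2 * r + 1) / q ^ (2 * (r + 1 + s) + 1)) * q ^ (2 * s + 2)) *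
          (q ^ (2 * r + 1) * (1 - q ^ (2 * r + 1) * q ^ (2 * (r + 1 + s) + 1))) := by ring
      _ = - (qShiftedPair q (q ^ (2 * (r + 1 + s) + 1)) 1 r * q ^ (2 * (r + 1 + s) * r + r) *
          (B q s * (1 - q ^ (2 * s + 2)))) *
          (q ^ (2 * r + 1) * (1 - q ^ (2 * r + 1) * q ^ (2 * (r + 1 + s) + 1))) := by
            rw [e]; ring
      _ = _ := by rw [ih]; ring

lemma qShiftedPair_two_eq {q : K} (h0 : q ≠ 0) {N r : ℕ} (hr : r ≤ N) :
    qShiftedPair q (q ^ (2 * N + 1)) 2 r * (1 - q ^ (2 * N + 1)) * q ^ (2 * N * r) * A q (N - r) =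
      (-1) ^ r * q ^ (r ^ 2) * A q (N + r + 1) := by
  induction r with
  | zero => simp [qShiftedPair, qShiftedFactorial_odd_succ, mul_comm]
  | succ r ih =>
    obtain ⟨s, rfl⟩ := Nat.exists_eq_add_of_le hr
    have ih := ih (by omega)
    rw [show r + 1 + s - r = s + 1 by omega, qShiftedFactorial_odd_succ q s] at ih
    rw [show r + 1 + s - (r + 1) = s by omega,
      show r + 1 + s + (r + 1) + 1 = (r + 1 + s + r + 1) + 1 by ring,
      qShiftedFactorial_odd_succ q (r + 1 + s + r + 1), qShiftedPair_succ]
    have e : (1 - q ^ (2 * r + 2) / q ^ (2 * (r + 1 + s) + 1)) * q ^ (2 * s + 1) =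
        - (1 - q ^ (2 * s + 1)) := by
      field_simp
      ring
    calc _ = (qShiftedPair q (q ^ (2 * (r + 1 + s) + 1)) 2 r * (1 - q ^ (2 * (r + 1 + s) + 1)) *
          q ^ (2 * (r + 1 + s) * r) *
          A q s) * ((1 - q ^ (2 * r + 2) / q ^ (2 * (r + 1 + s) + 1)) * q ^ (2 * s + 1)) *
          (q ^ (2 * r + 1) * (1 - q ^ (2 * r + 2) * q ^ (2 * (r + 1 + s) + 1))) := by ring
      _ = - (qShiftedPair q (q ^ (2 * (r + 1 + s) + 1)) 2 r * (1 - q ^ (2 * (r + 1 + s) + 1)) *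
          q ^ (2 * (r + 1 + s) * r) * (A q s * (1 - q ^ (2 * s + 1)))) *
          (q ^ (2 * r + 1) * (1 - q ^ (2 * r + 2) * q ^ (2 * (r + 1 + s) + 1))) := by
            rw [e]; ring
      _ = _ := by rw [ih]; ring

/-- The transformation of `watson_transformation` in terms of `q`-shifted factorials. -/
lemma watson_transformation_qShiftedPair {q : K} (h0 : q ≠ 0) (hq : ∀ m, 0 < m → 1 - q ^ m ≠ 0)
    (N : ℕ) :
    q ^ N * ∑ r ∈ Finset.range (N + 1), qInteger q (4 * r + 1) * (A q r ^ 4 / B q r ^ 4) *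
        (qShiftedPair q (q ^ (2 * N + 1)) 1 r / qShiftedPair q (q ^ (2 * N + 1)) 2 r) * q ^ r =
      qInteger q (2 * N + 1) * ∑ L ∈ Finset.range (N + 1), A q L ^ 2 *
        qShiftedPair q (q ^ (2 * N + 1)) 1 L / B q L ^ 4 * q ^ (2 * L) := by
  have hA := qShiftedFactorial_odd_ne_zero hq
  have hB := qShiftedFactorial_even_ne_zero hq
  have h1 : 1 - q ≠ 0 := by simpa using hq 1 one_pos
  have hn := hq (2 * N + 1) (by omega)
  have hint : ∀ m, qInteger q m = (1 - q ^ m) / (1 - q) := fun m => by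
    rw [eq_div_iff h1, qInteger, geom_sum_mul_neg]
  have hw := watson_transformation hq N
  have hl : ∀ r ∈ Finset.range (N + 1), qInteger q (4 * r + 1) * (A q r ^ 4 / B q r ^ 4) *
        (qShiftedPair q (q ^ (2 * N + 1)) 1 r / qShiftedPair q (q ^ (2 * N + 1)) 2 r) * q ^ r =
      (1 - q ^ (2 * N + 1)) / (1 - q) * ((1 - q ^ (4 * r + 1)) * A q r ^ 4 *
        B q (N + r) * A q (N - r) / (B q r ^ 4 * B q (N - r) * A q (N + r + 1))) := by
    intro r hr
    have hr := Nat.lt_succ_iff.1 (Finset.mem_range.1 hr)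
    have hU := eq_div_of_mul_eq (mul_ne_zero (pow_ne_zero _ h0) (hB (N - r)))
      ((mul_assoc _ _ _).symm.trans (qShiftedPair_one_eq h0 hr))
    have hV : qShiftedPair q (q ^ (2 * N + 1)) 2 r = (-1) ^ r * q ^ (r ^ 2) * A q (N + r + 1) /
        ((1 - q ^ (2 * N + 1)) * q ^ (2 * N * r) * A q (N - r)) := by
      rw [eq_div_iff (mul_ne_zero (mul_ne_zero hn (pow_ne_zero _ h0)) (hA _)),
        ← qShiftedPair_two_eq h0 hr]
      ring
    rw [hint, hU, hV]
    have := hB r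
    have := hB (N - r)
    have := hA (N - r)
    have := hA (N + r + 1)
    field_simp
    ring
  have hr : ∀ L ∈ Finset.range (N + 1), (-1) ^ L * q ^ ((N - L) ^ 2 + L) * A q L ^ 2 *
      B q (N + L) / (B q L ^ 4 * B q (N - L)) =
      q ^ (N ^ 2) * (A q L ^ 2 * qShiftedPair q (q ^ (2 * N + 1)) 1 L / B q L ^ 4 *
        q ^ (2 * L)) := by
    intro L hL
    obtain ⟨s, rfl⟩ := Nat.exists_eq_add_of_le (Nat.lt_succ_iff.1 (Finset.mem_range.1 hL))
    have hU := eq_div_of_mul_eq (mul_ne_zero (pow_ne_zero _ h0) (hB (L + s - L)))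
      ((mul_assoc _ _ _).symm.trans (qShiftedPair_one_eq h0 (Nat.le_add_right L s)))
    rw [hU, show L + s - L = s by omega]
    have := hB L
    have := hB s
    field_simp
    ring
  rw [Finset.sum_congr rfl hr, ← Finset.mul_sum] at hw
  rw [Finset.sum_congr rfl hl, ← Finset.mul_sum, hint]
  refine mul_left_cancel₀ (pow_ne_zero (N ^ 2) h0) ?_
  linear_combination (1 - q ^ (2 * N + 1)) / (1 - q) * hw

end Watson

/-! ### Cyclotomic valuations and the local behaviour of the summand -/

section Valuation

local notation:max "A" q:max k:max => qShiftedFactorial q (q ^ 2) k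
local notation:max "B" q:max k:max => qShiftedFactorial (q ^ 2) (q ^ 2) k

variable {K Γ₀ : Type*} [Field K] [LinearOrderedCommGroupWithZero Γ₀] {v : Valuation K Γ₀}

/-- Two `v`-integral elements of a valued field that agree up to an error of size at most `γ`. -/
structure Valuation.CongMod (v : Valuation K Γ₀) (γ : Γ₀) (x y : K) : Prop where
  left : v x ≤ 1
  right : v y ≤ 1
  sub_le : v (x - y) ≤ γ

namespace Valuation.CongMod

variable {γ : Γ₀} {x y z x' y' : K}

lemma refl (hx : v x ≤ 1) : v.CongMod γ x x := ⟨hx, hx, by simp⟩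

lemma symm (h : v.CongMod γ x y) : v.CongMod γ y x :=
  ⟨h.right, h.left, by rw [← v.map_neg, neg_sub]; exact h.sub_le⟩

lemma trans (h : v.CongMod γ x y) (h' : v.CongMod γ y z) : v.CongMod γ x z :=
  ⟨h.left, h'.right, by rw [← sub_add_sub_cancel]; exact v.map_add_le h.sub_le h'.sub_le⟩

lemma mul (h : v.CongMod γ x y) (h' : v.CongMod γ x' y') : v.CongMod γ (x * x') (y * y') := by
  refine ⟨?_, ?_, ?_⟩
  · rw [map_mul]; exact mul_le_one' h.left h'.left
  · rw [map_mul]; exact mul_le_one' h.right h'.right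
  · rw [show x * x' - y * y' = (x - y) * x' + y * (x' - y') by ring]
    refine v.map_add_le ?_ ?_
    · rw [map_mul]; exact (mul_le_mul' h.sub_le h'.left).trans_eq (mul_one _)
    · rw [map_mul]; exact (mul_le_mul' h.right h'.sub_le).trans_eq (one_mul _)

lemma pow (h : v.CongMod γ x y) (n : ℕ) : v.CongMod γ (x ^ n) (y ^ n) := by
  induction n with
  | zero => simpa using refl (by simp)
  | succ n ih => simpa only [pow_succ] using ih.mul h

lemma sum {ι : Type*} {s : Finset ι} {f g : ι → K} (h : ∀ i ∈ s, v.CongMod γ (f i) (g i)) :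
    v.CongMod γ (∑ i ∈ s, f i) (∑ i ∈ s, g i) :=
  ⟨v.map_sum_le fun i hi => (h i hi).left, v.map_sum_le fun i hi => (h i hi).right, by
    rw [← Finset.sum_sub_distrib]; exact v.map_sum_le fun i hi => (h i hi).sub_le⟩

lemma prod {ι : Type*} {s : Finset ι} {f g : ι → K} (h : ∀ i ∈ s, v.CongMod γ (f i) (g i)) :
    v.CongMod γ (∏ i ∈ s, f i) (∏ i ∈ s, g i) := by
  classical
  induction s using Finset.induction_on with
  | empty => simpa using refl (by simp)
  | insert a s ha ih =>
    rw [Finset.prod_insert ha, Finset.prod_insert ha]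
    exact (h a (Finset.mem_insert_self a s)).mul (ih fun i hi => h i (Finset.mem_insert_of_mem hi))

lemma eq_one (h : v.CongMod γ x y) (hγ : γ < 1) (hy : v y = 1) : v x = 1 := by
  rw [← hy]
  exact v.map_eq_of_sub_lt (by rw [hy]; exact h.sub_le.trans_lt hγ)

lemma inv (h : v.CongMod γ x y) (hγ : γ < 1) (hy : v y = 1) : v.CongMod γ x⁻¹ y⁻¹ := by
  have hx := h.eq_one hγ hy
  refine ⟨by simp [hx], by simp [hy], ?_⟩
  have hx0 : x ≠ 0 := by rintro rfl; simp at hx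
  have hy0 : y ≠ 0 := by rintro rfl; simp at hy
  rw [inv_sub_inv hx0 hy0, map_div₀, map_mul, hx, hy, mul_one, div_one]
  exact h.symm.sub_le

lemma div (h : v.CongMod γ x y) (h' : v.CongMod γ x' y') (hγ : γ < 1) (hy : v y' = 1) :
    v.CongMod γ (x / x') (y / y') := by
  simpa only [div_eq_mul_inv] using h.mul (h'.inv hγ hy)

end Valuation.CongMod

/-- The valuation `v` sees `q` as a lift of a primitive `d`-th root of unity, each `1 - q ^ m` with
`d ∣ m`, `0 < m` having the same valuation `ϖ`. -/
structure Valuation.IsCyclotomic (v : Valuation K Γ₀) (q : K) (d : ℕ) (ϖ : Γ₀) : Prop where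
  ne_zero : ϖ ≠ 0
  lt_one : ϖ < 1
  of_not_dvd : ∀ m, ¬ d ∣ m → v (1 - q ^ m) = 1
  of_dvd : ∀ m, 0 < m → d ∣ m → v (1 - q ^ m) = ϖ

/-- The summand `[4 k + 1] (q; q ^ 2)_k ^ 6 / (q ^ 2; q ^ 2)_k ^ 6 * q ^ k` over any field. -/
def cTermAt (q : K) (k : ℕ) : K :=
  qInteger q (4 * k + 1) * (A q k ^ 6 / B q k ^ 6) * q ^ k

namespace Valuation.IsCyclotomic

variable {q : K} {d M : ℕ} {ϖ : Γ₀}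

lemma one_sub_pow_ne_zero (h : v.IsCyclotomic q d ϖ) {m : ℕ} (hm : 0 < m) : 1 - q ^ m ≠ 0 := by
  intro h0
  by_cases hd : d ∣ m
  · exact h.ne_zero (by rw [← h.of_dvd m hm hd, h0, map_zero])
  · have := h.of_not_dvd m hd
    simp [h0] at this

/-- Since 1 - q^d is small, q^d has value 1, and a linearly ordered value group has no torsion. -/
lemma map_q (h : v.IsCyclotomic q d ϖ) (hd : 0 < d) : v q = 1 := by
  have h1 : v (q ^ d) = 1 := by
    have : v (1 - (1 - q ^ d)) = 1 :=
      v.map_one_sub_of_lt (by rw [h.of_dvd d hd dvd_rfl]; exact h.lt_one)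
    simpa using this
  rw [map_pow] at h1
  exact (pow_eq_one_iff.1 h1).resolve_right hd.ne'

lemma q_ne_zero (h : v.IsCyclotomic q d ϖ) (hd : 0 < d) : q ≠ 0 := by
  rintro rfl
  simpa using h.map_q hd

lemma map_pow_q (h : v.IsCyclotomic q d ϖ) (hd : 0 < d) (m : ℕ) : v (q ^ m) = 1 := by
  rw [map_pow, h.map_q hd, one_pow]

lemma map_one_sub_pow_le (h : v.IsCyclotomic q d ϖ) (hd : 0 < d) (m : ℕ) :
    v (1 - q ^ m) ≤ 1 :=
  v.map_sub_le (by simp) (h.map_pow_q hd m).le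

lemma map_one_sub_pow_mul_le (h : v.IsCyclotomic q d ϖ) (m : ℕ) : v (1 - q ^ (d * m)) ≤ ϖ := by
  rcases Nat.eq_zero_or_pos (d * m) with h0 | h0
  · simp [h0]
  · exact (h.of_dvd _ h0 (dvd_mul_right d m)).le

lemma map_qInteger_le (h : v.IsCyclotomic q d ϖ) (hd : 0 < d) (m : ℕ) : v (qInteger q m) ≤ 1 :=
  v.map_sum_le fun i _ => (h.map_pow_q hd i).le

lemma map_qInteger (h : v.IsCyclotomic q d ϖ) (hd : 1 < d) (m : ℕ) :
    v (qInteger q m) = v (1 - q ^ m) := by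
  have h1 : v (1 - q) = 1 := by simpa using h.of_not_dvd 1 (by simpa using hd.ne')
  rw [← geom_sum_mul_neg, map_mul, h1, mul_one, qInteger]

lemma congMod_pow (h : v.IsCyclotomic q d ϖ) (hd : 0 < d) (a m : ℕ) :
    v.CongMod ϖ (q ^ (d * a + m)) (q ^ m) := by
  refine ⟨(h.map_pow_q hd _).le, (h.map_pow_q hd _).le, ?_⟩
  rw [show q ^ (d * a + m) - q ^ m = - (q ^ m * (1 - q ^ (d * a))) by ring, v.map_neg, map_mul,
    h.map_pow_q hd, one_mul]
  exact h.map_one_sub_pow_mul_le a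

lemma congMod_one_sub_pow (h : v.IsCyclotomic q d ϖ) (hd : 0 < d) (a m : ℕ) :
    v.CongMod ϖ (1 - q ^ (d * a + m)) (1 - q ^ m) :=
  ⟨h.map_one_sub_pow_le hd _, h.map_one_sub_pow_le hd _, by
    rw [sub_sub_sub_cancel_left]; exact (h.congMod_pow hd a m).symm.sub_le⟩

lemma congMod_qInteger (h : v.IsCyclotomic q d ϖ) (hd : 1 < d) (a m : ℕ) :
    v.CongMod ϖ (qInteger q (d * a + m)) (qInteger q m) := by
  refine ⟨h.map_qInteger_le (by omega) _, h.map_qInteger_le (by omega) _, ?_⟩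
  rw [add_comm, show qInteger q (m + d * a) - qInteger q m = q ^ m * qInteger q (d * a) by
    simp only [qInteger, Finset.sum_range_add, Finset.mul_sum, pow_add]; ring, map_mul,
    h.map_pow_q (by omega), one_mul, h.map_qInteger hd]
  exact h.map_one_sub_pow_mul_le a

lemma map_odd_le_one (h : v.IsCyclotomic q d ϖ) (hd : 0 < d) (k : ℕ) : v (A q k) ≤ 1 := by
  rw [qShiftedFactorial, map_prod]
  exact Finset.prod_le_one' fun i _ => by
    rw [← pow_mul, ← pow_succ']; exact h.map_one_sub_pow_le hd _

/-- The factor of index M is 1 - q^{2M+1}. -/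
lemma map_odd_le (h : v.IsCyclotomic q (2 * M + 1) ϖ) {k : ℕ} (hk : M < k) : v (A q k) ≤ ϖ := by
  rw [qShiftedFactorial, map_prod, ← Finset.mul_prod_erase _ _ (Finset.mem_range.2 hk), ← pow_mul,
    ← pow_succ', h.of_dvd _ (by omega) dvd_rfl]
  refine (mul_le_mul' le_rfl (Finset.prod_le_one' fun i _ => ?_)).trans_eq (mul_one _)
  rw [← pow_mul, ← pow_succ']
  exact h.map_one_sub_pow_le (by omega) _

lemma map_even (h : v.IsCyclotomic q (2 * M + 1) ϖ) {k : ℕ} (hk : k ≤ 2 * M) :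
    v (B q k) = 1 := by
  rw [qShiftedFactorial, map_prod]
  refine Finset.prod_eq_one fun i hi => ?_
  rw [← pow_mul, ← pow_add]
  refine h.of_not_dvd _ fun hdvd => ?_
  rw [show 2 + 2 * i = 2 * (i + 1) by ring] at hdvd
  have := Nat.le_of_dvd (by omega)
    (Nat.Coprime.dvd_of_dvd_mul_left (by simp : Nat.Coprime (2 * M + 1) 2) hdvd)
  have := Finset.mem_range.1 hi
  omega

/-! ### Periodicity of the summand -/

/-- In each block of 2M + 1 consecutive factors, the denominator has exactly one non-unit, at the
last index, of value ϖ. The numerator has one at index M to compensate. -/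
lemma map_ratio_mul_le (h : v.IsCyclotomic q (2 * M + 1) ϖ) (hM : 0 < M) (a : ℕ) :
    v (A q ((2 * M + 1) * a) / B q ((2 * M + 1) * a)) ≤ 1 := by
  induction a with
  | zero => simp [qShiftedFactorial_zero]
  | succ a ih =>
    set T := (2 * M + 1) * a with hT
    have hA : v (∏ i ∈ Finset.range (2 * M + 1), (1 - q * (q ^ 2) ^ (T + i))) ≤ ϖ := by
      rw [map_prod, ← Finset.mul_prod_erase _ _ (Finset.mem_range.2 (by omega : M < 2 * M + 1)),
        ← pow_mul, ← pow_succ', h.of_dvd _ (by omega) ⟨2 * a + 1, by rw [hT]; ring⟩]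
      refine (mul_le_mul' le_rfl (Finset.prod_le_one' fun i _ => ?_)).trans_eq (mul_one _)
      rw [← pow_mul, ← pow_succ']
      exact h.map_one_sub_pow_le (by omega) _
    have hB : v (∏ i ∈ Finset.range (2 * M + 1), (1 - q ^ 2 * (q ^ 2) ^ (T + i))) = ϖ := by
      rw [map_prod, Finset.prod_range_succ, ← pow_mul, ← pow_add,
        h.of_dvd _ (by omega) ⟨2 * a + 2, by rw [hT]; ring⟩]
      rw [Finset.prod_eq_one, one_mul]
      intro i hi
      rw [← pow_mul, ← pow_add]
      refine h.of_not_dvd _ fun hdvd => ?_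
      rw [show 2 + 2 * (T + i) = (2 * M + 1) * (2 * a) + 2 * (i + 1) by rw [hT]; ring,
        Nat.dvd_add_right (dvd_mul_right _ _)] at hdvd
      have := Nat.le_of_dvd (by omega)
        (Nat.Coprime.dvd_of_dvd_mul_left (by simp : Nat.Coprime (2 * M + 1) 2) hdvd)
      have := Finset.mem_range.1 hi
      omega
    rw [mul_add, mul_one, ← hT, qShiftedFactorial, qShiftedFactorial,
      Finset.prod_range_add _ T (2 * M + 1), Finset.prod_range_add _ T (2 * M + 1),
      mul_div_mul_comm, map_mul, ← qShiftedFactorial, ← qShiftedFactorial]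
    refine mul_le_one' ih ?_
    rw [map_div₀, hB]
    exact div_le_one_of_le₀ hA zero_le

/-- The ratio `(q; q ^ 2)_{d a + b} / (q ^ 2; q ^ 2)_{d a + b}` agrees modulo `ϖ` with the product
of the ratios at `d a` and `b`. -/
lemma congMod_ratio (h : v.IsCyclotomic q (2 * M + 1) ϖ) (hM : 0 < M) (a : ℕ) {b : ℕ}
    (hb : b ≤ 2 * M) :
    v.CongMod ϖ (A q ((2 * M + 1) * a + b) / B q ((2 * M + 1) * a + b))
      (A q ((2 * M + 1) * a) / B q ((2 * M + 1) * a) * (A q b / B q b)) := by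
  rw [qShiftedFactorial, qShiftedFactorial, Finset.prod_range_add,
      Finset.prod_range_add, mul_div_mul_comm, ← qShiftedFactorial, ← qShiftedFactorial]
  refine (Valuation.CongMod.refl (h.map_ratio_mul_le hM a)).mul
    (.div (.prod fun i _ => ?_) (.prod fun i _ => ?_) h.lt_one (h.map_even hb))
  · rw [← pow_mul, ← pow_mul, ← pow_succ', ← pow_succ',
      show 2 * ((2 * M + 1) * a + i) + 1 = (2 * M + 1) * (2 * a) + (2 * i + 1) by ring]
    exact h.congMod_one_sub_pow (by omega) _ _
  · rw [← pow_mul, ← pow_mul, ← pow_add, ← pow_add,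
      show 2 + 2 * ((2 * M + 1) * a + i) = (2 * M + 1) * (2 * a) + (2 + 2 * i) by ring]
    exact h.congMod_one_sub_pow (by omega) _ _

lemma map_ratio_le (h : v.IsCyclotomic q (2 * M + 1) ϖ) (hM : 0 < M) (k : ℕ) :
    v (A q k / B q k) ≤ 1 := by
  have := (h.congMod_ratio hM (k / (2 * M + 1)) (b := k % (2 * M + 1))
    (Nat.lt_succ_iff.1 (Nat.mod_lt _ (by omega)))).left
  rwa [Nat.div_add_mod] at this

/-- A Lucas-type congruence: modulo ϖ the q-integer and the power of q depend only on b, while the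
ratio is multiplicative in the block and the remainder. -/
lemma congMod_cTermAt (h : v.IsCyclotomic q (2 * M + 1) ϖ) (hM : 0 < M) (a : ℕ) {b : ℕ}
    (hb : b ≤ 2 * M) :
    v.CongMod ϖ (cTermAt q ((2 * M + 1) * a + b))
      ((A q ((2 * M + 1) * a) / B q ((2 * M + 1) * a)) ^ 6 * cTermAt q b) := by
  have key := ((h.congMod_qInteger (by omega) (4 * a) (4 * b + 1)).mul
    ((h.congMod_ratio hM a hb).pow 6)).mul (h.congMod_pow (by omega) a b)
  rw [cTermAt, cTermAt, ← div_pow, ← div_pow]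
  convert key using 1
  · ring_nf
  · ring

lemma map_cTermAt_le_one (h : v.IsCyclotomic q (2 * M + 1) ϖ) (hM : 0 < M) (k : ℕ) :
    v (cTermAt q k) ≤ 1 := by
  rw [cTermAt, ← div_pow, map_mul, map_mul, h.map_pow_q (by omega), mul_one, map_pow]
  exact mul_le_one' (h.map_qInteger_le (by omega) _) (pow_le_one' (h.map_ratio_le hM k) 6)

lemma map_cTermAt_le (h : v.IsCyclotomic q (2 * M + 1) ϖ) {k : ℕ}
    (hk : M < k) (hk' : k ≤ 2 * M) : v (cTermAt q k) ≤ ϖ ^ 6 := by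
  rw [cTermAt, map_mul, map_mul, h.map_pow_q (by omega), mul_one, map_div₀, map_pow, map_pow,
    h.map_even hk', one_pow, div_one]
  exact (mul_le_mul' (h.map_qInteger_le (by omega) _)
    (pow_le_pow_left' (h.map_odd_le hk) 6)).trans_eq (one_mul _)

/-! ### The congruence obtained from Watson's transformation -/

/-- Each factor (1 - xy)(1 - x/y) is symmetric under y ↔ 1/y, so the first-order error at y = 1
vanishes: it differs from (1 - x)² by -x(1 - y)²/y, and y = q^d. -/
lemma congMod_qShiftedPair (h : v.IsCyclotomic q d ϖ) (hd : 0 < d) (e k : ℕ) :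
    v.CongMod (ϖ ^ 2) (qShiftedPair q (q ^ d) e k)
      ((∏ j ∈ Finset.range k, (1 - q ^ (2 * j + e))) ^ 2) := by
  rw [qShiftedPair, ← Finset.prod_pow]
  refine .prod fun j _ => ?_
  have h0 := pow_ne_zero d (h.q_ne_zero hd)
  have hx := h.map_pow_q hd (2 * j + e)
  have hy := h.map_pow_q hd d
  refine ⟨?_, ?_, ?_⟩
  · rw [map_mul]
    exact mul_le_one' (v.map_sub_le (by simp) (by simp [map_mul, hx, hy]))
      (v.map_sub_le (by simp) (by simp [map_div₀, hx, hy]))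
  · rw [map_pow]
    exact pow_le_one' (h.map_one_sub_pow_le hd _) 2
  · rw [show (1 - q ^ (2 * j + e) * q ^ d) * (1 - q ^ (2 * j + e) / q ^ d) -
        (1 - q ^ (2 * j + e)) ^ 2 = - (q ^ (2 * j + e) * (1 - q ^ d) ^ 2 / q ^ d) by
      field_simp; ring, v.map_neg, map_div₀, map_mul, map_pow _ (1 - q ^ d), hx, hy,
      h.of_dvd d hd dvd_rfl, one_mul, div_one]

lemma congMod_qShiftedPair_one (h : v.IsCyclotomic q d ϖ) (hd : 0 < d) (k : ℕ) :
    v.CongMod (ϖ ^ 2) (qShiftedPair q (q ^ d) 1 k) (A q k ^ 2) := by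
  convert h.congMod_qShiftedPair hd 1 k using 3
  exact Finset.prod_congr rfl fun j _ => by ring

lemma congMod_qShiftedPair_two (h : v.IsCyclotomic q d ϖ) (hd : 0 < d) (k : ℕ) :
    v.CongMod (ϖ ^ 2) (qShiftedPair q (q ^ d) 2 k) (B q k ^ 2) := by
  convert h.congMod_qShiftedPair hd 2 k using 3
  exact Finset.prod_congr rfl fun j _ => by ring

lemma congMod_sum_cTermAt (h : v.IsCyclotomic q (2 * M + 1) ϖ) (hM : 0 < M) :
    v.CongMod (ϖ ^ 2) (q ^ M * ∑ k ∈ Finset.range (M + 1), cTermAt q k)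
      (qInteger q (2 * M + 1) * ∑ k ∈ Finset.range (M + 1),
        A q k ^ 4 / B q k ^ 4 * q ^ (2 * k)) := by
  have hd : 0 < 2 * M + 1 := by omega
  have hϖ : ϖ ^ 2 < 1 := pow_lt_one' h.lt_one two_ne_zero
  have hw := watson_transformation_qShiftedPair (h.q_ne_zero hd)
    (fun m hm => h.one_sub_pow_ne_zero hm) M
  -- Two of the six ratios are deformed to the pairs at y = q^{2M+1}. After Watson, two numerator
  -- factors on the other side are deformed back.
  have hl : v.CongMod (ϖ ^ 2) (q ^ M * ∑ k ∈ Finset.range (M + 1), cTermAt q k)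
      (q ^ M * ∑ r ∈ Finset.range (M + 1), qInteger q (4 * r + 1) * (A q r ^ 4 / B q r ^ 4) *
        (qShiftedPair q (q ^ (2 * M + 1)) 1 r / qShiftedPair q (q ^ (2 * M + 1)) 2 r) *
          q ^ r) := by
    refine (Valuation.CongMod.refl (h.map_pow_q hd M).le).mul (.sum fun r hr => ?_)
    have hB : v (B q r) = 1 := h.map_even (by have := Finset.mem_range.1 hr; omega)
    have hB2 : v (B q r ^ 2) = 1 := by rw [map_pow, hB, one_pow]
    have hA := h.map_odd_le_one hd r
    rw [cTermAt, show A q r ^ 6 / B q r ^ 6 =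
      A q r ^ 4 / B q r ^ 4 * (A q r ^ 2 / B q r ^ 2) by rw [← div_pow, ← div_pow, ← div_pow]; ring,
      ← mul_assoc]
    refine .mul (.mul (.refl ?_) (Valuation.CongMod.symm (.div (h.congMod_qShiftedPair_one hd r)
      (h.congMod_qShiftedPair_two hd r) hϖ hB2))) (.refl (h.map_pow_q hd r).le)
    rw [map_mul, map_div₀, map_pow, map_pow, hB, one_pow, div_one]
    exact mul_le_one' (h.map_qInteger_le hd _) (pow_le_one' hA 4)
  rw [hw] at hl
  refine hl.trans (.mul (.refl (h.map_qInteger_le hd _)) (.sum fun r hr => ?_))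
  have hB : v (B q r ^ 4) = 1 := by
    rw [map_pow, h.map_even (by have := Finset.mem_range.1 hr; omega), one_pow]
  have hA : v (A q r ^ 2) ≤ 1 := by rw [map_pow]; exact pow_le_one' (h.map_odd_le_one hd r) 2
  refine .mul (.div ?_ (.refl hB.le) hϖ hB) (.refl (h.map_pow_q hd _).le)
  rw [show A q r ^ 4 = A q r ^ 2 * A q r ^ 2 by ring]
  exact .mul (.refl hA) (h.congMod_qShiftedPair_one hd r)

lemma map_sum_ratio_le_one (h : v.IsCyclotomic q (2 * M + 1) ϖ) (hM : 0 < M) (T : ℕ) :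
    v (∑ k ∈ Finset.range T, A q k ^ 4 / B q k ^ 4 * q ^ (2 * k)) ≤ 1 := by
  refine v.map_sum_le fun k _ => ?_
  rw [map_mul, h.map_pow_q (by omega), mul_one, ← div_pow, map_pow]
  exact pow_le_one' (h.map_ratio_le hM k) 4

lemma map_sum_cTermAt_le (h : v.IsCyclotomic q (2 * M + 1) ϖ) (hM : 0 < M) :
    v (∑ k ∈ Finset.range (M + 1), cTermAt q k) ≤ ϖ := by
  have hd : 0 < 2 * M + 1 := by omega
  have h1 := (h.congMod_sum_cTermAt hM).sub_le
  have h2 : v (qInteger q (2 * M + 1) * ∑ k ∈ Finset.range (M + 1),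
      A q k ^ 4 / B q k ^ 4 * q ^ (2 * k)) ≤ ϖ := by
    rw [map_mul, h.map_qInteger (by omega), h.of_dvd _ hd dvd_rfl]
    exact (mul_le_mul' le_rfl (h.map_sum_ratio_le_one hM _)).trans_eq (mul_one _)
  have h3 : v (q ^ M * ∑ k ∈ Finset.range (M + 1), cTermAt q k) ≤ ϖ := by
    rw [← sub_add_cancel (q ^ M * _) _]
    exact v.map_add_le (h1.trans (pow_le_of_le_one zero_le h.lt_one.le two_ne_zero)) h2
  rwa [map_mul, h.map_pow_q hd, one_mul] at h3

end Valuation.IsCyclotomic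

end Valuation

/-! ### Truncated convolution squares and block decompositions -/

section Convolution

lemma sum_range_mul_eq {R : Type*} [AddCommMonoid R] (g : ℕ → R) (d m : ℕ) :
    ∑ i ∈ Finset.range (d * m), g i =
      ∑ a ∈ Finset.range m, ∑ b ∈ Finset.range d, g (d * a + b) := by
  induction m with
  | zero => simp
  | succ m ih => rw [mul_add, mul_one, Finset.sum_range_add, Finset.sum_range_succ, ih]

lemma sum_convolution_eq {R : Type*} [CommRing R] (f : ℕ → R) (T : ℕ) :
    ∑ k ∈ Finset.range T, ∑ j ∈ Finset.range (k + 1), f j * f (k - j) =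
      ∑ i ∈ Finset.range T, ∑ j ∈ Finset.range T, if i + j < T then f i * f j else 0 := by
  rw [Finset.sum_comm' (s' := fun i => Finset.Ico i T) (t' := Finset.range T)
      (by intro x y; simp only [Finset.mem_range, Finset.mem_Ico]; omega)]
  refine Finset.sum_congr rfl fun i hi => ?_
  rw [Finset.sum_Ico_eq_sum_range, ← Finset.sum_filter]
  refine Finset.sum_congr ?_ fun j _ => by rw [Nat.add_sub_cancel_left]
  ext j
  simp only [Finset.mem_range, Finset.mem_filter]
  omega

/-- A truncated convolution square factors when the sequence is a product of a function of the
quotient and a function of the remainder modulo `2 M + 1`, the latter supported on `[0, M]`. -/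
lemma sum_convolution_of_block {R : Type*} [CommRing R] {f l e : ℕ → R} {M m : ℕ}
    (hf : ∀ a < m, ∀ b < 2 * M + 1, f ((2 * M + 1) * a + b) = l a * e b)
    (he : ∀ b, M < b → e b = 0) :
    ∑ k ∈ Finset.range ((2 * M + 1) * m), ∑ j ∈ Finset.range (k + 1), f j * f (k - j) =
      (∑ a ∈ Finset.range m, ∑ a' ∈ Finset.range m, if a + a' < m then l a * l a' else 0) *
        (∑ b ∈ Finset.range (M + 1), e b) ^ 2 := by
  have hE : ∑ b ∈ Finset.range (M + 1), e b = ∑ b ∈ Finset.range (2 * M + 1), e b := by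
    refine Finset.sum_subset (Finset.range_subset_range.2 (by omega)) fun b _ hb => he b ?_
    simpa using hb
  rw [sum_convolution_eq, sum_range_mul_eq, hE, sq, Finset.sum_mul]
  refine Finset.sum_congr rfl fun a ha => ?_
  have ha := Finset.mem_range.1 ha
  have : ∀ b ∈ Finset.range (2 * M + 1), (∑ j ∈ Finset.range ((2 * M + 1) * m),
      if (2 * M + 1) * a + b + j < (2 * M + 1) * m then f ((2 * M + 1) * a + b) * f j else 0) =
      e b * ((∑ a' ∈ Finset.range m, if a + a' < m then l a * l a' else 0) *
        ∑ b' ∈ Finset.range (2 * M + 1), e b') := by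
    intro b hb
    have hb := Finset.mem_range.1 hb
    rw [sum_range_mul_eq, Finset.sum_mul, Finset.mul_sum]
    refine Finset.sum_congr rfl fun a' ha' => ?_
    have ha' := Finset.mem_range.1 ha'
    rw [Finset.mul_sum, Finset.mul_sum]
    refine Finset.sum_congr rfl fun b' hb' => ?_
    have hb' := Finset.mem_range.1 hb'
    rw [hf a ha b hb, hf a' ha' b' hb']
    by_cases hbM : M < b
    · simp [he b hbM]
    by_cases hbM' : M < b'
    · simp [he b' hbM']
    -- No carry occurs: b + b' ≤ 2M, so the truncation condition involves only the quotients.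
    have hiff : (2 * M + 1) * a + b + ((2 * M + 1) * a' + b') < (2 * M + 1) * m ↔
        a + a' < m := by
      constructor
      · intro hlt
        refine lt_of_mul_lt_mul_left (a := 2 * M + 1) ?_ (Nat.zero_le _)
        rw [mul_add]
        omega
      · intro hlt
        have := Nat.mul_le_mul_left (2 * M + 1) (Nat.succ_le_of_lt hlt)
        rw [Nat.succ_eq_add_one, mul_add, mul_add, mul_one] at this
        omega
    simp only [hiff]
    split_ifs <;> ring
  rw [Finset.sum_congr rfl this, ← Finset.sum_mul]
  ring

end Convolution

/-! ### Local estimates for the convolution of the summand -/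

section Valuation

local notation:max "A" q:max k:max => qShiftedFactorial q (q ^ 2) k
local notation:max "B" q:max k:max => qShiftedFactorial (q ^ 2) (q ^ 2) k

variable {K Γ₀ : Type*} [Field K] [LinearOrderedCommGroupWithZero Γ₀] {v : Valuation K Γ₀}

lemma Valuation.CongMod.convolution {γ : Γ₀} {f g : ℕ → K} {T : ℕ}
    (h : ∀ k < T, v.CongMod γ (f k) (g k)) :
    v.CongMod γ (∑ k ∈ Finset.range T, ∑ j ∈ Finset.range (k + 1), f j * f (k - j))
      (∑ k ∈ Finset.range T, ∑ j ∈ Finset.range (k + 1), g j * g (k - j)) := by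
  refine .sum fun k hk => .sum fun j hj => ?_
  have hk := Finset.mem_range.1 hk
  have hj := Finset.mem_range.1 hj
  exact .mul (h j (by omega)) (h (k - j) (by omega))

namespace Valuation.IsCyclotomic

variable {q : K} {M : ℕ} {ϖ : Γ₀}

lemma congMod_truncate (h : v.IsCyclotomic q (2 * M + 1) ϖ) (hM : 0 < M) {b : ℕ}
    (hb : b ≤ 2 * M) :
    v.CongMod (ϖ ^ 6) (cTermAt q b) (if b ≤ M then cTermAt q b else 0) := by
  split_ifs with hbM
  · exact .refl (h.map_cTermAt_le_one hM b)
  · exact ⟨h.map_cTermAt_le_one hM b, by simp, by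
      rw [sub_zero]; exact h.map_cTermAt_le (by omega) hb⟩

/-- Dropping the terms above M costs ϖ⁶, and what remains is a single block (m = 1, l = 1), where
truncation loses nothing. -/
lemma map_convolution_sub_le (h : v.IsCyclotomic q (2 * M + 1) ϖ) (hM : 0 < M) :
    v (∑ k ∈ Finset.range (2 * M + 1), ∑ j ∈ Finset.range (k + 1),
      cTermAt q j * cTermAt q (k - j) - (∑ k ∈ Finset.range (M + 1), cTermAt q k) ^ 2) ≤
        ϖ ^ 6 := by
  have h1 := (Valuation.CongMod.convolution (T := 2 * M + 1)
    fun k hk => h.congMod_truncate hM (Nat.lt_succ_iff.1 hk)).sub_le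
  have h2 := sum_convolution_of_block (M := M) (m := 1)
    (f := fun b => if b ≤ M then cTermAt q b else 0) (l := fun _ => 1)
    (e := fun b => if b ≤ M then cTermAt q b else 0)
    (fun a ha b hb => by obtain rfl : a = 0 := by omega
                         simp)
    (fun b hb => if_neg (by omega))
  rw [mul_one] at h2
  rw [h2] at h1
  convert h1 using 3
  simp only [Finset.range_one, Finset.sum_singleton, add_zero, Nat.lt_one_iff, if_true, one_mul]
  congr 1
  exact Finset.sum_congr rfl fun b hb =>
    (if_pos (Nat.lt_succ_iff.1 (Finset.mem_range.1 hb))).symm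

lemma map_convolution_le (h : v.IsCyclotomic q (2 * M + 1) ϖ) (hM : 0 < M) (m : ℕ) :
    v (∑ k ∈ Finset.range ((2 * M + 1) * m), ∑ j ∈ Finset.range (k + 1),
      cTermAt q j * cTermAt q (k - j)) ≤ ϖ := by
  set l : ℕ → K := fun a => (A q ((2 * M + 1) * a) / B q ((2 * M + 1) * a)) ^ 6 with hl
  set e : ℕ → K := fun b => if b ≤ M then cTermAt q b else 0 with he
  have hl1 : ∀ a, v (l a) ≤ 1 := fun a => by
    rw [hl, map_pow]; exact pow_le_one' (h.map_ratio_le hM _) 6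
  have hd : 0 < 2 * M + 1 := by omega
  have h1 := Valuation.CongMod.convolution (v := v) (γ := ϖ) (T := (2 * M + 1) * m) (f := cTermAt q)
    (g := fun k => l (k / (2 * M + 1)) * e (k % (2 * M + 1))) fun k _ => by
      have hk : k % (2 * M + 1) ≤ 2 * M := Nat.lt_succ_iff.1 (Nat.mod_lt _ hd)
      have hc := h.congMod_cTermAt hM (k / (2 * M + 1)) hk
      rw [Nat.div_add_mod] at hc
      have ht := h.congMod_truncate hM hk
      exact hc.trans (.mul (.refl (hl1 _)) ⟨ht.left, ht.right,
        ht.sub_le.trans (pow_le_of_le_one zero_le h.lt_one.le (by norm_num))⟩)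
  have h2 := sum_convolution_of_block (M := M) (m := m)
    (f := fun k => l (k / (2 * M + 1)) * e (k % (2 * M + 1))) (l := l) (e := e)
    (fun a ha b hb => by
      rw [Nat.mul_add_div hd, Nat.div_eq_of_lt hb, Nat.mul_add_mod, Nat.mod_eq_of_lt hb, add_zero])
    (fun b hb => if_neg (by omega))
  have h3 : ∑ b ∈ Finset.range (M + 1), e b = ∑ b ∈ Finset.range (M + 1), cTermAt q b :=
    Finset.sum_congr rfl fun b hb => if_pos (Nat.lt_succ_iff.1 (Finset.mem_range.1 hb))
  rw [h3] at h2
  have h4 := h.map_sum_cTermAt_le hM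
  rw [h2] at h1
  rw [← sub_add_cancel (Finset.sum _ _) (_ * _)]
  refine v.map_add_le h1.sub_le ?_
  rw [map_mul, map_pow]
  -- The sum over quotients is integral, and one of the two factors C already supplies ϖ.
  refine (mul_le_mul' (v.map_sum_le fun a _ => v.map_sum_le fun a' _ => ?_)
    (pow_le_of_le_one zero_le (h4.trans h.lt_one.le) two_ne_zero)).trans
      ((one_mul _).trans_le h4)
  split_ifs
  · rw [map_mul]; exact mul_le_one' (hl1 a) (hl1 a')
  · simp

/-- The congruence for the truncated convolution square modulo the cube of `ϖ`. -/
lemma map_convolution_sub_sq_le (h : v.IsCyclotomic q (2 * M + 1) ϖ) (hM : 0 < M) :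
    v (∑ k ∈ Finset.range (2 * M + 1), ∑ j ∈ Finset.range (k + 1),
        cTermAt q j * cTermAt q (k - j) -
      (q ^ M)⁻¹ ^ 2 * qInteger q (2 * M + 1) ^ 2 *
        (∑ k ∈ Finset.range (M + 1), A q k ^ 4 / B q k ^ 4 * q ^ (2 * k)) ^ 2) ≤ ϖ ^ 3 := by
  have hd : 0 < 2 * M + 1 := by omega
  have hq0 : q ^ M ≠ 0 := pow_ne_zero _ (h.q_ne_zero hd)
  have h1 := (h.map_convolution_sub_le hM).trans
    (pow_le_pow_right_of_le_one' h.lt_one.le (by norm_num : 3 ≤ 6))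
  have h2 := (h.congMod_sum_cTermAt hM).sub_le
  have h3 := h.map_sum_cTermAt_le hM
  have h4 := h.map_sum_ratio_le_one hM (M + 1)
  have h5 := h.map_qInteger (by omega) (2 * M + 1)
  rw [h.of_dvd _ hd dvd_rfl] at h5
  have hqM := h.map_pow_q hd M
  set c := ∑ k ∈ Finset.range (M + 1), cTermAt q k
  set s := ∑ k ∈ Finset.range (M + 1), A q k ^ 4 / B q k ^ 4 * q ^ (2 * k)
  set n := qInteger q (2 * M + 1)
  have h6 : v (q ^ M * c + n * s) ≤ ϖ := by
    refine v.map_add_le ?_ ?_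
    · rwa [map_mul, hqM, one_mul]
    · rw [map_mul, h5]; exact (mul_le_mul' le_rfl h4).trans_eq (mul_one _)
  rw [← sub_add_sub_cancel _ (c ^ 2)]
  refine v.map_add_le h1 ?_
  -- Difference of squares: the minus factor has size at most ϖ² by Watson, the plus factor at most
  -- ϖ.
  rw [show c ^ 2 - (q ^ M)⁻¹ ^ 2 * n ^ 2 * s ^ 2 =
    (q ^ M)⁻¹ ^ 2 * ((q ^ M * c - n * s) * (q ^ M * c + n * s)) by field_simp; ring]
  rw [map_mul, map_mul, map_pow, map_inv₀, hqM, inv_one, one_pow, one_mul, pow_succ]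
  exact mul_le_mul' h2 h6

end Valuation.IsCyclotomic

end Valuation

/-! ### Cyclotomic places of ℚ(q) and reassembly of the modulus -/

section Cyclotomic

open IsDedekindDomain

/-- The place of `ℚ(q)` at the `d`-th cyclotomic polynomial. -/
def cyclotomicPlace (d : ℕ) (hd : 0 < d) : HeightOneSpectrum ℚ[X] where
  asIdeal := Ideal.span {cyclotomic d ℚ}
  isPrime := (Ideal.span_singleton_prime (cyclotomic_ne_zero d ℚ)).2
    (cyclotomic.irreducible_rat hd).prime
  ne_bot := by simpa using cyclotomic_ne_zero d ℚ

lemma cyclotomicPlace_valuation (d : ℕ) (hd : 0 < d) (e : ℕ) :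
    (cyclotomicPlace d hd).valuation (RatFunc ℚ) (algebraMap ℚ[X] (RatFunc ℚ) (cyclotomic e ℚ)) =
      if e = d then WithZero.exp (-1 : ℤ) else 1 := by
  rw [HeightOneSpectrum.valuation_of_algebraMap]
  split_ifs with h
  · subst h
    exact HeightOneSpectrum.intValuation_singleton _ (cyclotomic_ne_zero e ℚ) rfl
  · rw [HeightOneSpectrum.intValuation_eq_one_iff]
    intro hmem
    have hdvd := Ideal.mem_span_singleton.1 hmem
    exact (cyclotomic.irreducible_rat hd).not_isUnit
      ((cyclotomic.isCoprime_rat h).isUnit_of_dvd' hdvd dvd_rfl)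

/-- Φ_d occurs in q^m - 1 = ∏_{e ∣ m} Φ_e exactly once if d ∣ m, and the other factors are coprime
to it. -/
lemma cyclotomicPlace_isCyclotomic (d : ℕ) (hd : 0 < d) :
    ((cyclotomicPlace d hd).valuation (RatFunc ℚ)).IsCyclotomic RatFunc.X d
      (WithZero.exp (-1 : ℤ)) := by
  have key : ∀ m, 0 < m → (cyclotomicPlace d hd).valuation (RatFunc ℚ) (1 - RatFunc.X ^ m) =
      if d ∣ m then WithZero.exp (-1 : ℤ) else 1 := by
    intro m hm
    have hX : (1 - RatFunc.X ^ m : RatFunc ℚ) =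
        - algebraMap ℚ[X] (RatFunc ℚ) (∏ e ∈ m.divisors, cyclotomic e ℚ) := by
      rw [prod_cyclotomic_eq_X_pow_sub_one hm]
      simp
    rw [hX, Valuation.map_neg, map_prod, map_prod]
    simp only [cyclotomicPlace_valuation]
    rw [Finset.prod_ite_eq']
    simp [hm.ne']
  refine ⟨WithZero.exp_ne_zero, ?_, fun m hm => ?_, fun m hm hdm => ?_⟩
  · rw [← WithZero.exp_zero, WithZero.exp_lt_exp]; norm_num
  · rcases Nat.eq_zero_or_pos m with rfl | h0
    · simp at hm
    · rw [key m h0, if_neg hm]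
  · rw [key m hm, if_pos hdm]

/-- The numerator is x times the denominator, and the denominator, being a polynomial, has value at
most 1. -/
lemma pow_cyclotomic_dvd_num {d : ℕ} (hd : 0 < d) {x : RatFunc ℚ} {k : ℕ}
    (hx : (cyclotomicPlace d hd).valuation (RatFunc ℚ) x ≤ WithZero.exp (-1 : ℤ) ^ k) :
    cyclotomic d ℚ ^ k ∣ x.num := by
  have h1 : (cyclotomicPlace d hd).intValuation x.num ≤ WithZero.exp (-(k : ℤ)) := by
    rw [← HeightOneSpectrum.valuation_of_algebraMap (K := RatFunc ℚ)]
    have hnum : algebraMap ℚ[X] (RatFunc ℚ) x.num = x * algebraMap ℚ[X] (RatFunc ℚ) x.denom := by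
      nth_rewrite 2 [← RatFunc.num_div_denom x]
      rw [div_mul_cancel₀]
      simpa using x.denom_ne_zero
    change (cyclotomicPlace d hd).valuation (RatFunc ℚ) (algebraMap ℚ[X] (RatFunc ℚ) x.num) ≤ _
    rw [hnum, map_mul]
    refine (mul_le_mul' hx (HeightOneSpectrum.valuation_le_one _ _)).trans_eq ?_
    rw [mul_one, ← WithZero.exp_nsmul]
    simp
  rw [HeightOneSpectrum.intValuation_le_pow_iff_dvd] at h1
  rwa [show (cyclotomicPlace d hd).asIdeal = Ideal.span {cyclotomic d ℚ} from rfl,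
    Ideal.span_singleton_pow, Ideal.dvd_span_singleton, Ideal.mem_span_singleton] at h1

/-- Divisibility by `[n] Φ_n ^ 2` may be tested one cyclotomic factor at a time. -/
lemma qInteger_mul_cyclotomic_sq_dvd {n : ℕ} (hn : 1 < n) {p : ℚ[X]}
    (h : ∀ d, 1 < d → d ∣ n → cyclotomic d ℚ ^ (if d = n then 3 else 1) ∣ p) :
    qInteger (X : ℚ[X]) n * cyclotomic n ℚ ^ 2 ∣ p := by
  have hmem : n ∈ n.divisors.erase 1 := by simp; omega
  have hprod : qInteger (X : ℚ[X]) n * cyclotomic n ℚ ^ 2 =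
      ∏ d ∈ n.divisors.erase 1, cyclotomic d ℚ ^ (if d = n then 3 else 1) := by
    have herase : ∏ d ∈ (n.divisors.erase 1).erase n, cyclotomic d ℚ ^ (if d = n then 3 else 1) =
        ∏ d ∈ (n.divisors.erase 1).erase n, cyclotomic d ℚ :=
      Finset.prod_congr rfl fun d hd => by rw [if_neg (Finset.ne_of_mem_erase hd), pow_one]
    rw [qInteger, ← prod_cyclotomic_eq_geom_sum (by omega), ← Finset.mul_prod_erase _ _ hmem,
      ← Finset.mul_prod_erase _ _ hmem, if_pos rfl, herase]
    ring
  rw [hprod]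
  refine Finset.prod_dvd_of_coprime (fun d _ e _ hde => ?_) fun d hd => ?_
  · exact (cyclotomic.isCoprime_rat hde).pow
  · simp only [Finset.mem_erase, Nat.mem_divisors] at hd
    refine h d ?_ hd.2.1
    have := Nat.pos_of_dvd_of_pos hd.2.1 (by omega)
    omega

end Cyclotomic

end

theorem theorem8 (n : ℕ) (hn : Odd n) :
    RatFuncCongruent (qInteger (X : ℚ[X]) n * cyclotomic n ℚ ^ 2)
      (∑ k ∈ Finset.range n, ∑ j ∈ Finset.range (k + 1), cTerm j * cTerm (k - j))
      ((RatFunc.X : RatFunc ℚ) ^ (1 - (n : ℤ)) * qInteger (RatFunc.X : RatFunc ℚ) n ^ 2 *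
        (∑ k ∈ Finset.range ((n - 1) / 2 + 1),
          qShiftedFactorial (RatFunc.X : RatFunc ℚ) (RatFunc.X ^ 2) k ^ 4 /
            qShiftedFactorial (RatFunc.X ^ 2 : RatFunc ℚ) (RatFunc.X ^ 2) k ^ 4 *
              RatFunc.X ^ (2 * k)) ^ 2) := by
  have hc : cTerm = cTermAt RatFunc.X := rfl
  obtain ⟨N, rfl⟩ := hn
  have hX : (RatFunc.X : RatFunc ℚ) ^ (1 - ((2 * N + 1 : ℕ) : ℤ)) = (RatFunc.X ^ N)⁻¹ ^ 2 := by
    rw [inv_pow, ← pow_mul, ← zpow_natCast, ← zpow_neg]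
    congr 1
    push_cast
    ring
  rw [RatFuncCongruent, hX, hc, show (2 * N + 1 - 1) / 2 = N by omega]
  rcases Nat.eq_zero_or_pos N with rfl | hN
  -- For n = 1 both sides equal 1.
  · simp [cTermAt, qInteger, qShiftedFactorial]
  refine qInteger_mul_cyclotomic_sq_dvd (by omega) fun d hd hdn => ?_
  have hv := cyclotomicPlace_isCyclotomic d (by omega)
  refine pow_cyclotomic_dvd_num (by omega) ?_
  split_ifs with h
  · subst h
    exact hv.map_convolution_sub_sq_le hN
  obtain ⟨m, hm⟩ := hdn
  obtain ⟨M, rfl⟩ : Odd d := (Nat.odd_mul.1 (hm ▸ odd_two_mul_add_one N)).1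
  have hM : 0 < M := by omega
  rw [pow_one]
  -- For a proper divisor d each side is divisible by Φ_d separately.
  refine Valuation.map_sub_le _ ?_ ?_
  · rw [hm]
    exact hv.map_convolution_le hM m
  · have hint := hv.map_one_sub_pow_mul_le m
    rw [← hm, ← hv.map_qInteger (by omega)] at hint
    rw [map_mul, map_mul, map_pow, map_inv₀, hv.map_pow_q (by omega), inv_one, one_pow, one_mul,
      map_pow, map_pow]
    refine (mul_le_mul' (pow_le_of_le_one zero_le (hint.trans hv.lt_one.le) two_ne_zero)
      (pow_le_one' (hv.map_sum_ratio_le_one hM _) 2)).trans ?_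
    rwa [mul_one]
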